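/- Consider Boolean formulas on $n$ variables built from unbounded fan-in $\mathrm{AND}$, $\mathrm{OR}$ and $\mathrm{MOD}_2$ gates (a $\mathrm{MOD}_2$ gate outputs $1$ iff an odd number of its inputs are $1$) and $\mathrm{NOT}$ gates, with leaves labelled by variables or constants ($\mathrm{AC}^0[\oplus]$ formulas). The size of a formula is its number of leaves; its depth is the maximum number of $\mathrm{AND}$, $\mathrm{OR}$, $\mathrm{MOD}_2$ gates on a path from the output to a leaf ($\mathrm{NOT}$ gates are not counted, which only enlarges the class of formulas of depth at most $d$). Let $\mathrm{Maj}_n:\{0,1\}^n\to\{0,1\}$ be the function with $\mathrm{Maj}_n(x)=1$ iff more than $n/2$ coordinates of $x$ are $1$. A $(1/4,n)$-Approximate Majority is a function $f:\{0,1\}^n\to\{0,1\}$ such that $\Pr_{x}[f(x)\ne \mathrm{Maj}_n(x)]\le 1/4$ for uniformly random $x\in\{0,1\}^n$. For every constant $K>0$ there are constants $c>0$ and $n_0\in\mathbb{N}$, depending only on $K$ (in particular, independent of $n$, of $d$ and of the function), such that for all $n\ge n_0$, all integers $d$ with $2\le d\le K\log n$, and every $(1/4,n)$-Approximate Majority $f$,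 every $\mathrm{AC}^0[\oplus]$ formula of depth at most $d$ that computes $f$ has size at least $$\exp\bigl(c\, d\, n^{1/(2(d-1))}\bigr).$$ -/

import Mathlib

/-- The Hamming weight `|x|₁` of a Boolean vector. -/
def hammingWeight {n : ℕ} (x : Fin n → Bool) : ℕ :=
  (Finset.univ.filter fun i => x i = true).card

/-- The Majority function: `1` if and only if `|x|₁ > n / 2`. -/
def majority (n : ℕ) (x : Fin n → Bool) : Bool :=
  decide ((n : ℚ) / 2 < (hammingWeight x : ℚ))

/-- `f` is an `(ε, n)`-Approximate Majority: for uniformly random `x ∈ {0,1}ⁿ`,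
the probability that `f x ≠ Maj_n x` is at most `ε`. -/
def IsApproxMajority {n : ℕ} (ε : ℝ) (f : (Fin n → Bool) → Bool) : Prop :=
  ((Finset.univ.filter fun x : Fin n → Bool => f x ≠ majority n x).card : ℝ) / 2 ^ n ≤ ε

/-- Boolean formulas over the basis of `NOT` and unbounded (positive) fan-in `AND`, `OR`, `MOD₂`
gates. Leaves are variables or constants (so that fan-in `0` gates are not needed). -/
inductive ParityFormula (n : ℕ) : Type
  | var (i : Fin n) : ParityFormula n
  | const (b : Bool) : ParityFormula n
  | not (F : ParityFormula n) : ParityFormula n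
  | and {k : ℕ} (F : Fin (k + 1) → ParityFormula n) : ParityFormula n
  | or {k : ℕ} (F : Fin (k + 1) → ParityFormula n) : ParityFormula n
  | mod2 {k : ℕ} (F : Fin (k + 1) → ParityFormula n) : ParityFormula n

namespace ParityFormula

/-- The value of a formula at an input. A `MOD₂` gate outputs `1` if and only if an odd number of
its inputs are `1`. -/
def eval {n : ℕ} (x : Fin n → Bool) : ParityFormula n → Bool
  | var i => x i
  | const b => b
  | not F => !(F.eval x)
  | and F => decide (∀ i, (F i).eval x = true)
  | or F => decide (∃ i, (F i).eval x = true)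
  | mod2 F => decide (Odd (Finset.univ.filter fun i => (F i).eval x = true).card)

/-- The size of a formula: its number of leaves. -/
def size {n : ℕ} : ParityFormula n → ℕ
  | var _ => 1
  | const _ => 1
  | not F => F.size
  | and F => ∑ i, (F i).size
  | or F => ∑ i, (F i).size
  | mod2 F => ∑ i, (F i).size

/-- The depth of a formula: the largest number of `AND`, `OR`, `MOD₂` gates on a path from the
output to a leaf. `NOT` gates are not counted; so a formula that has depth at most `d` when they
are counted also has depth at most `d` in this sense. -/
def depth {n : ℕ} : ParityFormula n → ℕ
  | var _ => 0
  | const _ => 0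
  | not F => F.depth
  | and F => (Finset.univ.sup fun i => (F i).depth) + 1
  | or F => (Finset.univ.sup fun i => (F i).depth) + 1
  | mod2 F => (Finset.univ.sup fun i => (F i).depth) + 1

/-- `F` computes `f` if they agree on every input. -/
def Computes {n : ℕ} (F : ParityFormula n) (f : (Fin n → Bool) → Bool) : Prop :=
  ∀ x, F.eval x = f x

end ParityFormula

/-!
The proof follows Razborov, Smolensky, and Rossman and Srinivasan. A formula is approximated by
random low-degree polynomials over `𝔽₂`, and Majority is far from every such polynomial.

*Upper bound on the degree.* A formula is `1/16`-approximated by a random polynomial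
(`IsApproximable`), built from the leaves to the output. At a gate whose children have sizes `sᵢ`
with sum `S`, the error of child `i` is first reduced from `1/16` to `sᵢ / (32 S)` by taking the
majority of `O(log (S / sᵢ) + 1)` independent samples (`IsApproximable.amplify`), which multiplies
the degree by that number. The errors of the children then sum to `1/32`, and the gate itself costs
a constant factor in the degree and `1/32` in the error (`IsApproximable.or`). The saving over a
plain union bound is that an unbalanced child, with `S / sᵢ` large, is itself small: by the
inequality of arithmetic and geometric means (`mul_div_pow_le`), a formula of size `s` and depth
`e + 1` needs degree only `O(log s / e + 1) ^ e` up to a constant factor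
(`ParityFormula.exists_isApproximable`). For the leaves no error reduction is needed, which
makes the exponent `e` rather than `e + 1`.

*Lower bound on the degree.* A polynomial that agrees with Majority on an `11/16` fraction of the
cube has degree of order `√n` (`sqrt_le_of_approximates_majority`): on the set of agreement every
function has degree at most `n / 2 + D`, and dimensions are compared.

Together these give `n ^ (1 / (2 e)) = O(log s / e + 1)`. If the left side exceeds a large constant,
the summand `1` is absorbed and the bound follows. Otherwise the claim is only that `log s` is at
least of order `d`, which is `O(log n)`; this holds because a formula of size `s` has degree at most
`s` exactly, so that `s` is at least of order `√n` (`ParityFormula.log_le_log_size`).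
-/

/-! ### Low-degree polynomial functions on the cube -/

/-- A bit as an element of `𝔽₂`. -/
def bitToF2 (b : Bool) : ZMod 2 := if b then 1 else 0

/-- The multilinear monomial `∏ i ∈ T, xᵢ`, as an `𝔽₂`-valued function on the cube. -/
def cubeMonomial {n : ℕ} (T : Finset (Fin n)) (x : Fin n → Bool) : ZMod 2 :=
  ∏ i ∈ T, bitToF2 (x i)

/-- The functions on the cube that are given by polynomials over `𝔽₂` of degree at most `D`.
As `xᵢ² = xᵢ` on the cube, multilinear monomials suffice. -/
def lowDegree (n D : ℕ) : Submodule (ZMod 2) ((Fin n → Bool) → ZMod 2) :=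
  Submodule.span (ZMod 2) (cubeMonomial '' {T : Finset (Fin n) | T.card ≤ D})

theorem ZMod.two_eq_zero_or_one (a : ZMod 2) : a = 0 ∨ a = 1 := by
  revert a; decide

theorem cubeMonomial_mem {n D : ℕ} {T : Finset (Fin n)} (h : T.card ≤ D) :
    cubeMonomial T ∈ lowDegree n D :=
  Submodule.subset_span ⟨T, h, rfl⟩

theorem cubeMonomial_mul {n : ℕ} (S T : Finset (Fin n)) :
    (cubeMonomial S : (Fin n → Bool) → ZMod 2) * cubeMonomial T = cubeMonomial (S ∪ T) := by
  funext x
  have key : ∀ U : Finset (Fin n), cubeMonomial U x = if ∀ i ∈ U, x i = true then 1 else 0 := by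
    intro U
    rw [cubeMonomial]
    simp only [bitToF2, Finset.prod_boole]
    congr
  rw [Pi.mul_apply, key, key, key, mul_ite, mul_one, mul_zero, ← ite_and]
  simp only [Finset.mem_union, or_imp, forall_and, and_comm]

theorem lowDegree_mono {n a b : ℕ} (h : a ≤ b) : lowDegree n a ≤ lowDegree n b :=
  Submodule.span_mono (Set.image_mono fun _ hT => le_trans hT h)

theorem one_mem_lowDegree (n D : ℕ) : (1 : (Fin n → Bool) → ZMod 2) ∈ lowDegree n D := by
  have h := cubeMonomial_mem (n := n) (D := D) (T := ∅) (by simp)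
  convert h using 1
  funext x
  simp [cubeMonomial]

theorem mul_mem_lowDegree {n a b : ℕ} {p q : (Fin n → Bool) → ZMod 2}
    (hp : p ∈ lowDegree n a) (hq : q ∈ lowDegree n b) : p * q ∈ lowDegree n (a + b) := by
  have h : lowDegree n a * lowDegree n b ≤ lowDegree n (a + b) := by
    rw [lowDegree, lowDegree, Submodule.span_mul_span]
    refine Submodule.span_le.2 ?_
    rintro _ ⟨_, ⟨S, hS, rfl⟩, _, ⟨T, hT, rfl⟩, rfl⟩
    simp only [Set.mem_ofPred_eq] at hS hT
    simp only [cubeMonomial_mul]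
    exact cubeMonomial_mem ((Finset.card_union_le S T).trans (by omega))
  exact h (Submodule.mul_mem_mul hp hq)

theorem prod_mem_lowDegree {n : ℕ} {ι : Type*} (s : Finset ι) {D : ι → ℕ}
    {p : ι → (Fin n → Bool) → ZMod 2} (hp : ∀ i ∈ s, p i ∈ lowDegree n (D i)) :
    ∏ i ∈ s, p i ∈ lowDegree n (∑ i ∈ s, D i) := by
  classical
  induction s using Finset.induction_on with
  | empty => simpa using one_mem_lowDegree n 0
  | insert i s hi ih =>
    rw [Finset.prod_insert hi, Finset.sum_insert hi]
    exact mul_mem_lowDegree (hp i (Finset.mem_insert_self i s))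
      (ih fun j hj => hp j (Finset.mem_insert_of_mem hj))

theorem const_mem_lowDegree {n : ℕ} (D : ℕ) (a : ZMod 2) :
    (fun _ => a : (Fin n → Bool) → ZMod 2) ∈ lowDegree n D := by
  convert (lowDegree n D).smul_mem a (one_mem_lowDegree n D) using 1
  funext x; simp

theorem coord_mem_lowDegree {n : ℕ} (i : Fin n) :
    (fun x => bitToF2 (x i)) ∈ lowDegree n 1 := by
  convert cubeMonomial_mem (n := n) (D := 1) (T := {i}) (by simp) using 1
  funext x; simp [cubeMonomial]

theorem comp_mem_lowDegree {n t D : ℕ} (g : (Fin t → ZMod 2) → ZMod 2)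
    {p : Fin t → (Fin n → Bool) → ZMod 2} (hp : ∀ j, p j ∈ lowDegree n D) :
    (fun x => g fun j => p j x) ∈ lowDegree n (t * D) := by
  -- The product is the indicator polynomial of the point `b`.
  have h : (fun x => g fun j => p j x) =
      ∑ b : Fin t → ZMod 2, g b • ∏ j, (p j + fun _ => b j + 1) := by
    funext x
    have hd : ∀ a b : ZMod 2, a + (b + 1) = if a = b then 1 else 0 := by decide
    simp only [Finset.sum_apply, Pi.smul_apply, Finset.prod_apply, Pi.add_apply, smul_eq_mul, hd]
    rw [Finset.sum_eq_single (fun j => p j x)]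
    · simp
    · intro b _ hb
      obtain ⟨j, hj⟩ := Function.ne_iff.1 hb
      rw [Finset.prod_eq_zero (Finset.mem_univ j) (if_neg fun h => hj h.symm), mul_zero]
    · simp
  rw [h]
  refine Submodule.sum_mem _ fun b _ => Submodule.smul_mem _ _ ?_
  have := prod_mem_lowDegree (n := n) Finset.univ (D := fun _ : Fin t => D)
    (p := fun j => p j + fun _ => b j + 1)
    fun j _ => Submodule.add_mem _ (hp j) (const_mem_lowDegree _ _)
  simpa using this

theorem mem_lowDegree_self {n : ℕ} (g : (Fin n → Bool) → ZMod 2) : g ∈ lowDegree n n := by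
  have h := comp_mem_lowDegree (n := n) (fun y => g fun i => decide (y i = 1))
    fun i => coord_mem_lowDegree i
  rw [mul_one] at h
  convert h using 1
  funext x
  congr 1
  funext i
  cases h : x i <;> simp [bitToF2, h]

/-- Dropping the monomials of degree above `k` does not change a polynomial on the Hamming ball of
radius `k`. -/
theorem exists_lowDegree_eqOn_ball {n : ℕ} (k : ℕ) (g : (Fin n → Bool) → ZMod 2) :
    ∃ p ∈ lowDegree n k, ∀ x, hammingWeight x ≤ k → p x = g x := by
  have hg := mem_lowDegree_self g
  rw [lowDegree] at hg
  induction hg using Submodule.span_induction with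
  | mem g hg =>
    obtain ⟨T, -, rfl⟩ := hg
    by_cases hT : T.card ≤ k
    · exact ⟨_, cubeMonomial_mem hT, fun _ _ => rfl⟩
    · refine ⟨0, Submodule.zero_mem _, fun x hx => ?_⟩
      have : ∃ i ∈ T, x i ≠ true := by
        by_contra! hall
        refine hT (le_trans (Finset.card_le_card fun i hi => ?_) hx)
        simpa using hall i hi
      obtain ⟨i, hi, hxi⟩ := this
      exact (Finset.prod_eq_zero hi (by simp [bitToF2, hxi])).symm
  | zero => exact ⟨0, Submodule.zero_mem _, fun _ _ => rfl⟩
  | add g h _ _ ihg ihh =>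
    obtain ⟨p, hp, hpg⟩ := ihg
    obtain ⟨q, hq, hqh⟩ := ihh
    exact ⟨p + q, Submodule.add_mem _ hp hq, fun x hx => by simp [hpg x hx, hqh x hx]⟩
  | smul a g _ ih =>
    obtain ⟨p, hp, hpg⟩ := ih
    exact ⟨a • p, Submodule.smul_mem _ _ hp, fun x hx => by simp [hpg x hx]⟩

theorem comp_compl_mem_lowDegree {n D : ℕ} {p : (Fin n → Bool) → ZMod 2}
    (hp : p ∈ lowDegree n D) : (fun x => p fun i => !x i) ∈ lowDegree n D := by
  rw [lowDegree] at hp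
  induction hp using Submodule.span_induction with
  | mem p hp =>
    obtain ⟨T, hT, rfl⟩ := hp
    have h : (fun x : Fin n → Bool => cubeMonomial T fun i => !x i) =
        ∏ i ∈ T, ((fun x => bitToF2 (x i)) + 1) := by
      funext x
      simp only [cubeMonomial, Finset.prod_apply, Pi.add_apply, Pi.one_apply]
      refine Finset.prod_congr rfl fun i _ => ?_
      cases x i <;> decide
    rw [h]
    refine lowDegree_mono ?_ (prod_mem_lowDegree T (D := fun _ => 1) fun i _ =>
      Submodule.add_mem _ (coord_mem_lowDegree i) (one_mem_lowDegree n 1))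
    simpa using hT
  | zero => exact Submodule.zero_mem _
  | add p q _ _ ihp ihq => exact Submodule.add_mem _ ihp ihq
  | smul a p _ ih => exact Submodule.smul_mem _ a ih

theorem finrank_lowDegree_le (n D : ℕ) :
    Module.finrank (ZMod 2) (lowDegree n D) ≤
      (Finset.univ.filter fun T : Finset (Fin n) => T.card ≤ D).card := by
  classical
  have h : cubeMonomial '' {T : Finset (Fin n) | T.card ≤ D} =
      (((Finset.univ.filter fun T : Finset (Fin n) => T.card ≤ D).image cubeMonomial :
        Finset ((Fin n → Bool) → ZMod 2)) : Set ((Fin n → Bool) → ZMod 2)) := by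
    simp
  rw [lowDegree, h]
  exact (finrank_span_finset_le_card _).trans Finset.card_image_le

/-! ### Low-degree polynomials do not approximate Majority -/

theorem hammingWeight_compl {n : ℕ} (x : Fin n → Bool) :
    hammingWeight (fun i => !x i) + hammingWeight x = n := by
  have h := Finset.card_filter_add_card_filter_not (s := (Finset.univ : Finset (Fin n)))
    (fun i => x i = true)
  rw [Finset.card_univ, Fintype.card_fin] at h
  simp only [hammingWeight, Bool.not_eq_true', ← Bool.not_eq_true]
  omega

/-- Every function `g` equals `g₀ + Maj * (g₀ + g₁)` with `g₀`, `g₁` of degree at most `n / 2`, so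
where Majority agrees with a polynomial of degree `D`, all functions have degree at most
`n / 2 + D`. -/
theorem card_agree_majority_le {n D : ℕ} {p : (Fin n → Bool) → ZMod 2} (hp : p ∈ lowDegree n D) :
    (Finset.univ.filter fun x => p x = bitToF2 (majority n x)).card ≤
      (Finset.univ.filter fun T : Finset (Fin n) => T.card ≤ n / 2 + D).card := by
  set S := Finset.univ.filter fun x => p x = bitToF2 (majority n x)
  refine le_trans ?_ (finrank_lowDegree_le n (n / 2 + D))
  let φ : lowDegree n (n / 2 + D) →ₗ[ZMod 2] (S → ZMod 2) :=
    (LinearMap.funLeft (ZMod 2) (ZMod 2) (Subtype.val : S → (Fin n → Bool))).comp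
      (Submodule.subtype _)
  have hφ : Function.Surjective φ := by
    intro g
    obtain ⟨g', hg'⟩ : ∃ g' : (Fin n → Bool) → ZMod 2, ∀ x : S, g' x = g x := by
      classical
      exact ⟨fun x => if h : x ∈ S then g ⟨x, h⟩ else 0, fun x => by simp⟩
    obtain ⟨g₀, hg₀, hg₀'⟩ := exists_lowDegree_eqOn_ball (n / 2) g'
    obtain ⟨h₁, hh₁, hh₁'⟩ := exists_lowDegree_eqOn_ball (n / 2) fun x => g' fun i => !x i
    have hg₁ := comp_compl_mem_lowDegree hh₁
    set g₁ : (Fin n → Bool) → ZMod 2 := fun x => h₁ fun i => !x i with hg₁def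
    refine ⟨⟨g₀ + (g₀ + g₁) * p, Submodule.add_mem _ (lowDegree_mono (by omega) hg₀)
      (mul_mem_lowDegree (Submodule.add_mem _ hg₀ hg₁) hp)⟩, ?_⟩
    funext ⟨x, hx⟩
    have hpx : p x = bitToF2 (majority n x) := (Finset.mem_filter.1 hx).2
    change g₀ x + (g₀ x + g₁ x) * p x = g ⟨x, hx⟩
    rw [← hg' ⟨x, hx⟩, hpx]
    change _ = g' x
    have hw := hammingWeight_compl x
    by_cases hm : n < 2 * hammingWeight x
    · have hmaj : majority n x = true := by
        have : (n : ℚ) < 2 * hammingWeight x := by exact_mod_cast hm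
        simp only [majority, decide_eq_true_eq]; linarith
      have e : g₁ x = g' x := by
        rw [hg₁def]
        change h₁ (fun i => !x i) = _
        rw [hh₁' _ (by omega)]
        simp
      rw [hmaj, ← e]
      simp only [bitToF2, if_true, mul_one]
      rw [← add_assoc, CharTwo.add_self_eq_zero, zero_add]
    · have hmaj : majority n x = false := by
        have : (2 * hammingWeight x : ℚ) ≤ n := by exact_mod_cast not_lt.1 hm
        simp only [majority, decide_eq_false_iff_not, not_lt]; linarith
      rw [hmaj, ← hg₀' x (by omega)]
      simp [bitToF2]
  have := LinearMap.finrank_le_finrank_of_surjective hφ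
  simpa using this

theorem centralBinom_sq_mul_le (m : ℕ) : m.centralBinom ^ 2 * (2 * m + 1) ≤ 16 ^ m := by
  induction m with
  | zero => simp
  | succ m ih =>
    have h := Nat.succ_mul_centralBinom_succ m
    refine le_of_mul_le_mul_left ?_ (show 0 < (m + 1) ^ 2 by positivity)
    calc (m + 1) ^ 2 * ((m + 1).centralBinom ^ 2 * (2 * (m + 1) + 1))
        = ((m + 1) * (m + 1).centralBinom) ^ 2 * (2 * m + 3) := by ring
      _ = (m.centralBinom ^ 2 * (2 * m + 1)) * (4 * ((2 * m + 1) * (2 * m + 3))) := by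
          rw [h]; ring
      _ ≤ 16 ^ m * (4 * (4 * (m + 1) ^ 2)) := by
          refine Nat.mul_le_mul ih (Nat.mul_le_mul_left 4 ?_)
          nlinarith
      _ = (m + 1) ^ 2 * 16 ^ (m + 1) := by ring

theorem choose_half_sq_mul_le (n : ℕ) : n.choose (n / 2) ^ 2 * n ≤ 4 ^ n := by
  obtain ⟨m, rfl | rfl⟩ := Nat.even_or_odd' n
  · have h := centralBinom_sq_mul_le m
    rw [Nat.mul_div_cancel_left m two_pos, ← Nat.centralBinom_eq_two_mul_choose, pow_mul]
    norm_num
    nlinarith [sq_nonneg m.centralBinom]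
  · have h := centralBinom_sq_mul_le (m + 1)
    have e : (m + 1).centralBinom = 2 * (2 * m + 1).choose m := by
      rw [Nat.centralBinom_eq_two_mul_choose, Nat.mul_add, Nat.mul_one,
        Nat.choose_succ_succ' (2 * m + 1) m, Nat.choose_symm_half]
      ring
    rw [e] at h
    rw [show (2 * m + 1) / 2 = m by omega]
    have : 4 ^ (2 * m + 1) * 4 = 16 ^ (m + 1) := by
      rw [← pow_succ, show 2 * m + 1 + 1 = 2 * (m + 1) by ring, pow_mul]
      norm_num
    nlinarith [sq_nonneg ((2 * m + 1).choose m)]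

theorem card_subsets_card_le (n D : ℕ) :
    2 * (Finset.univ.filter fun T : Finset (Fin n) => T.card ≤ n / 2 + D).card ≤
      2 ^ n + 2 * ((D + 1) * n.choose (n / 2)) := by
  classical
  set A := Finset.univ.filter fun T : Finset (Fin n) => 2 * T.card < n
  set B := Finset.univ.filter fun T : Finset (Fin n) => n < 2 * T.card
  have hAB : A.card ≤ B.card := by
    refine Finset.card_le_card_of_injOn compl ?_ (compl_injective.injOn)
    intro T hT
    have hT' : 2 * T.card < n := by simpa [A] using hT
    have := Finset.card_compl T
    rw [Fintype.card_fin] at this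
    simp only [B, Finset.coe_filter, Finset.mem_univ, true_and, Set.mem_ofPred_eq]
    omega
  have hdisj : Disjoint A B := by
    rw [Finset.disjoint_filter]; intro T _ h; omega
  have h2 : A.card + B.card ≤ 2 ^ n := by
    rw [← Finset.card_union_of_disjoint hdisj]
    exact (Finset.card_le_univ _).trans (by simp)
  have hsub : (Finset.univ.filter fun T : Finset (Fin n) => T.card ≤ n / 2 + D) ⊆
      A ∪ (Finset.range (D + 1)).biUnion fun j =>
        Finset.powersetCard (n / 2 + j) (Finset.univ : Finset (Fin n)) := by
    intro T hT
    have hT' : T.card ≤ n / 2 + D := by simpa using hT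
    by_cases h : 2 * T.card < n
    · exact Finset.mem_union_left _ (by simpa [A] using h)
    · refine Finset.mem_union_right _ (Finset.mem_biUnion.2 ⟨T.card - n / 2, ?_, ?_⟩)
      · rw [Finset.mem_range]; omega
      · rw [Finset.mem_powersetCard]
        exact ⟨Finset.subset_univ _, by omega⟩
  have h3 := (Finset.card_le_card hsub).trans (Finset.card_union_le _ _)
  have h4 : ((Finset.range (D + 1)).biUnion fun j =>
      Finset.powersetCard (n / 2 + j) (Finset.univ : Finset (Fin n))).card ≤
      (D + 1) * n.choose (n / 2) := by
    refine Finset.card_biUnion_le.trans ?_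
    refine (Finset.sum_le_card_nsmul _ _ (n.choose (n / 2)) fun j _ => ?_).trans (by simp)
    rw [Finset.card_powersetCard, Finset.card_univ, Fintype.card_fin]
    exact Nat.choose_le_middle _ _
  omega

/-- Smolensky's bound: a polynomial that differs from Majority on at most a `5/16` fraction of the
cube has degree of order `√n`. -/
theorem sqrt_le_of_approximates_majority {n D : ℕ} {p : (Fin n → Bool) → ZMod 2}
    (hp : p ∈ lowDegree n D)
    (h : ((Finset.univ.filter fun x => p x ≠ bitToF2 (majority n x)).card : ℝ) ≤
      5 / 16 * 2 ^ n) :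
    3 / 16 * √n ≤ D + 1 := by
  have h1 := card_agree_majority_le hp
  have h2 := card_subsets_card_le n D
  have h3 := Finset.card_filter_add_card_filter_not (s := Finset.univ)
    (fun x => p x = bitToF2 (majority n x))
  have h4 : (n.choose (n / 2) : ℝ) * √n ≤ 2 ^ n := by
    refine le_of_sq_le_sq ?_ (by positivity)
    rw [mul_pow, Real.sq_sqrt (Nat.cast_nonneg n), ← pow_mul, mul_comm n 2, pow_mul]
    norm_num
    exact_mod_cast choose_half_sq_mul_le n
  simp only [Finset.card_univ, Fintype.card_pi, Fintype.card_bool, Finset.prod_const,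
    Fintype.card_fin] at h3
  simp only [ne_eq] at h
  have h5 : ((Finset.univ.filter fun x => p x = bitToF2 (majority n x)).card : ℝ) +
      (Finset.univ.filter fun x => ¬p x = bitToF2 (majority n x)).card = 2 ^ n := by
    exact_mod_cast h3
  have h6 : 2 * ((Finset.univ.filter fun x => p x = bitToF2 (majority n x)).card : ℝ) ≤
      2 ^ n + 2 * ((D + 1) * n.choose (n / 2)) := by
    exact_mod_cast (by omega :
      2 * (Finset.univ.filter fun x => p x = bitToF2 (majority n x)).card ≤ _)
  have h7 : 3 / 16 * (2 : ℝ) ^ n ≤ (D + 1) * n.choose (n / 2) := by linarith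
  refine le_of_mul_le_mul_right ?_ (show (0 : ℝ) < 2 ^ n by positivity)
  calc 3 / 16 * √n * 2 ^ n = 3 / 16 * 2 ^ n * √n := by ring
    _ ≤ (D + 1) * n.choose (n / 2) * √n := by gcongr
    _ = (D + 1) * (n.choose (n / 2) * √n) := by ring
    _ ≤ (D + 1) * 2 ^ n := by gcongr

/-! ### Random low-degree polynomials -/

/-- `f` has a random polynomial of degree at most `D` that errs with probability at most `ε` at
every point. The random polynomial is a finite family `P`, from which a member is drawn
uniformly. -/
def IsApproximable {n : ℕ} (ε : ℝ) (D : ℕ) (f : (Fin n → Bool) → ZMod 2) : Prop :=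
  ∃ (Ω : Type) (_ : Fintype Ω) (_ : Nonempty Ω) (P : Ω → (Fin n → Bool) → ZMod 2),
    (∀ ω, P ω ∈ lowDegree n D) ∧
      ∀ x, ((Finset.univ.filter fun ω => P ω x ≠ f x).card : ℝ) ≤ ε * Fintype.card Ω

/-- The strict majority of `t` elements of `𝔽₂`. -/
def majorityF2 {t : ℕ} (y : Fin t → ZMod 2) : ZMod 2 :=
  if t < 2 * (Finset.univ.filter fun j => y j = 1).card then 1 else 0

/-- If the majority of `y` is not `a`, then at least half of the entries of `y` are not `a`. -/
theorem le_card_ne_of_majorityF2_ne {t : ℕ} {y : Fin t → ZMod 2} {a : ZMod 2}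
    (h : majorityF2 y ≠ a) : t ≤ 2 * (Finset.univ.filter fun j => y j ≠ a).card := by
  rw [majorityF2] at h
  have hsplit := Finset.card_filter_add_card_filter_not (s := (Finset.univ : Finset (Fin t)))
    (fun j => y j = 1)
  rw [Finset.card_univ, Fintype.card_fin] at hsplit
  have hne : ∀ a : ZMod 2, a ≠ 0 ↔ a = 1 := by decide
  rcases ZMod.two_eq_zero_or_one a with rfl | rfl
  · simp only [hne]
    split_ifs at h with hc
    · omega
    · exact absurd rfl h
  · split_ifs at h with hc
    · exact absurd rfl h
    · simp only [ne_eq]; omega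

namespace IsApproximable

theorem of_mem {n D : ℕ} {f : (Fin n → Bool) → ZMod 2} (h : f ∈ lowDegree n D) :
    IsApproximable 0 D f :=
  ⟨Unit, inferInstance, inferInstance, fun _ => f, fun _ => h, fun x => by simp⟩

theorem mono {n a b : ℕ} {ε δ : ℝ} {f : (Fin n → Bool) → ZMod 2} (h : IsApproximable ε a f)
    (hε : ε ≤ δ) (hD : a ≤ b) : IsApproximable δ b f := by
  obtain ⟨Ω, _, _, P, hP, herr⟩ := h
  exact ⟨Ω, _, ‹_›, P, fun ω => lowDegree_mono hD (hP ω),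
    fun x => (herr x).trans (by gcongr)⟩

theorem add_one {n D : ℕ} {ε : ℝ} {f : (Fin n → Bool) → ZMod 2} (h : IsApproximable ε D f) :
    IsApproximable ε D (f + 1) := by
  obtain ⟨Ω, _, _, P, hP, herr⟩ := h
  refine ⟨Ω, inferInstance, inferInstance, fun ω => P ω + 1, fun ω => Submodule.add_mem _ (hP ω)
    (one_mem_lowDegree n D), fun x => ?_⟩
  simpa using herr x

/-- Averaging over the points: some member of the family errs on at most an `ε` fraction of the
cube. -/
theorem exists_card_ne_le {n D : ℕ} {ε : ℝ} {f : (Fin n → Bool) → ZMod 2}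
    (h : IsApproximable ε D f) :
    ∃ p ∈ lowDegree n D, ((Finset.univ.filter fun x => p x ≠ f x).card : ℝ) ≤ ε * 2 ^ n := by
  obtain ⟨Ω, _, _, P, hP, herr⟩ := h
  have hsum : ∑ ω, ((Finset.univ.filter fun x => P ω x ≠ f x).card : ℝ) ≤
      ∑ _ω : Ω, ε * 2 ^ n := by
    calc ∑ ω, ((Finset.univ.filter fun x => P ω x ≠ f x).card : ℝ)
        = ∑ x, ((Finset.univ.filter fun ω => P ω x ≠ f x).card : ℝ) := by
          simp only [Finset.card_filter, Nat.cast_sum]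
          exact Finset.sum_comm
      _ ≤ ∑ _x : Fin n → Bool, ε * Fintype.card Ω := Finset.sum_le_sum fun x _ => herr x
      _ = ∑ _ω : Ω, ε * 2 ^ n := by simp; ring
  obtain ⟨ω, -, hω⟩ := Finset.exists_le_of_sum_le Finset.univ_nonempty hsum
  exact ⟨P ω, hP ω, hω⟩

/-- Error reduction: the majority of `t` independent samples errs with probability at most
`2⁻ᵗ`. The bound comes from the exponential moment of the number of wrong samples. -/
theorem amplify {n D : ℕ} {f : (Fin n → Bool) → ZMod 2} (h : IsApproximable (1 / 16) D f)
    (t : ℕ) : IsApproximable ((1 / 2) ^ t) (t * D) f := by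
  obtain ⟨Ω, _, _, P, hP, herr⟩ := h
  refine ⟨Fin t → Ω, inferInstance, inferInstance, fun ω x => majorityF2 fun j => P (ω j) x,
    fun ω => comp_mem_lowDegree majorityF2 fun j => hP (ω j), fun x => ?_⟩
  -- The weight 16 of a wrong sample gives weight at least `4ᵗ` to a wrong majority, while the mean
  -- weight of a sample is at most `2`.
  set w : Ω → ℝ := fun ω => if P ω x ≠ f x then 16 else 1 with hw
  have hbad : ∀ ω : Fin t → Ω, majorityF2 (fun j => P (ω j) x) ≠ f x →
      (4 : ℝ) ^ t ≤ ∏ j, w (ω j) := by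
    intro ω hω
    have hprod : ∏ j, w (ω j) =
        (4 : ℝ) ^ (2 * (Finset.univ.filter fun j => P (ω j) x ≠ f x).card) := by
      rw [hw, Finset.prod_ite, Finset.prod_const, Finset.prod_const_one, mul_one, pow_mul]
      norm_num
    rw [hprod]
    exact pow_le_pow_right₀ (by norm_num) (le_card_ne_of_majorityF2_ne hω)
  have hsum : ∑ ω, w ω ≤ 2 * Fintype.card Ω := by
    have : ∀ ω, w ω = 15 * (if P ω x ≠ f x then 1 else 0) + 1 := by
      intro ω; simp only [hw]; split_ifs <;> norm_num
    simp only [this, Finset.sum_add_distrib, ← Finset.mul_sum, Finset.sum_boole]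
    have := herr x
    simp only [Finset.sum_const, Finset.card_univ, nsmul_eq_mul, mul_one]
    linarith
  have hw0 : ∀ ω, 0 ≤ w ω := by
    intro ω; simp only [hw]; split_ifs <;> norm_num
  set E := Finset.univ.filter fun ω : Fin t → Ω => majorityF2 (fun j => P (ω j) x) ≠ f x
  have key : (E.card : ℝ) * 4 ^ t ≤ (2 * Fintype.card Ω) ^ t := by
    calc (E.card : ℝ) * 4 ^ t = ∑ _ω ∈ E, (4 : ℝ) ^ t := by simp
      _ ≤ ∑ ω ∈ E, ∏ j, w (ω j) := by
          refine Finset.sum_le_sum fun ω hω => ?_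
          rw [Finset.mem_filter_univ] at hω
          exact hbad ω hω
      _ ≤ ∑ ω : Fin t → Ω, ∏ j, w (ω j) :=
          Finset.sum_le_univ_sum_of_nonneg fun ω => Finset.prod_nonneg fun j _ => hw0 (ω j)
      _ = (∑ ω, w ω) ^ t := by
          rw [← Fin.prod_const, Finset.prod_univ_sum, Fintype.piFinset_univ]
      _ ≤ (2 * Fintype.card Ω) ^ t := by
          gcongr
  rw [Fintype.card_pi, Finset.prod_const, Finset.card_univ, Fintype.card_fin, Nat.cast_pow]
  refine le_of_mul_le_mul_right (key.trans (le_of_eq ?_)) (show (0 : ℝ) < 4 ^ t by positivity)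
  rw [← mul_pow, ← mul_pow]
  congr 1
  ring

end IsApproximable

theorem card_pi_filter_apply {ι : Type} [Fintype ι] [DecidableEq ι] {Ω : ι → Type}
    [∀ i, Fintype (Ω i)] [∀ i, DecidableEq (Ω i)] (i : ι) (B : Finset (Ω i)) :
    (Finset.univ.filter fun ω : ∀ j, Ω j => ω i ∈ B).card * Fintype.card (Ω i) =
      B.card * Fintype.card (∀ j, Ω j) := by
  have h : (Finset.univ.filter fun ω : ∀ j, Ω j => ω i ∈ B) =
      Fintype.piFinset (Function.update (fun j => (Finset.univ : Finset (Ω j))) i B) := by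
    ext ω
    simp only [Finset.mem_filter, Finset.mem_univ, true_and, Fintype.mem_piFinset]
    constructor
    · intro h j
      by_cases hj : j = i
      · subst hj; simpa using h
      · simp [Function.update_of_ne hj]
    · intro h; simpa using h i
  have hp : ∏ j ∈ Finset.univ.erase i,
      (Function.update (fun j => (Finset.univ : Finset (Ω j))) i B j).card =
      ∏ j ∈ Finset.univ.erase i, Fintype.card (Ω j) := by
    refine Finset.prod_congr rfl fun j hj => ?_
    rw [Function.update_of_ne (Finset.ne_of_mem_erase hj), Finset.card_univ]
  rw [h, Fintype.card_piFinset, Fintype.card_pi,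
    ← Finset.mul_prod_erase Finset.univ _ (Finset.mem_univ i), hp,
    ← Finset.mul_prod_erase Finset.univ (fun j => Fintype.card (Ω j)) (Finset.mem_univ i),
    Function.update_self]
  ring

/-- Composition of random polynomials, by a union bound. The outer function `g` is approximated by
the uniform family `Q`, and `Q r` multiplies degrees by at most `c`. -/
theorem IsApproximable.comp {n D c : ℕ} {ι : Type} [Fintype ι] {ε : ι → ℝ} {δ : ℝ}
    {f : ι → (Fin n → Bool) → ZMod 2} (hf : ∀ i, IsApproximable (ε i) D (f i))
    {R : Type} [Fintype R] [Nonempty R] (g : (ι → ZMod 2) → ZMod 2)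
    (Q : R → (ι → ZMod 2) → ZMod 2)
    (hQ : ∀ r, ∀ p : ι → (Fin n → Bool) → ZMod 2, (∀ i, p i ∈ lowDegree n D) →
      (fun x => Q r fun i => p i x) ∈ lowDegree n (c * D))
    (hg : ∀ y, ((Finset.univ.filter fun r => Q r y ≠ g y).card : ℝ) ≤ δ * Fintype.card R) :
    IsApproximable (δ + ∑ i, ε i) (c * D) fun x => g fun i => f i x := by
  classical
  choose Ω h1 h2 P hP herr using hf
  refine ⟨R × (∀ i, Ω i), inferInstance, inferInstance,
    fun ω x => Q ω.1 fun i => P i (ω.2 i) x, fun ω => hQ ω.1 _ fun i => hP i (ω.2 i),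
    fun x => ?_⟩
  set y : ι → ZMod 2 := fun i => f i x with hy
  set E₀ := Finset.univ.filter fun r => Q r y ≠ g y
  set E : ∀ i, Finset (Ω i) := fun i => Finset.univ.filter fun ω => P i ω x ≠ f i x with hE
  set E' : ι → Finset (∀ i, Ω i) := fun i => Finset.univ.filter fun ω => ω i ∈ E i with hE'
  have hsub : (Finset.univ.filter fun ω : R × (∀ i, Ω i) =>
      Q ω.1 (fun i => P i (ω.2 i) x) ≠ g y) ⊆
      E₀ ×ˢ Finset.univ ∪ Finset.univ.biUnion fun i => Finset.univ ×ˢ E' i := by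
    rintro ⟨r, ω⟩ hω
    by_cases hall : ∀ i, P i (ω i) x = f i x
    · refine Finset.mem_union_left _ ?_
      simp only [Finset.mem_filter, Finset.mem_univ, true_and, hall] at hω
      simpa [E₀] using hω
    · obtain ⟨i, hi⟩ := not_forall.1 hall
      refine Finset.mem_union_right _ (Finset.mem_biUnion.2 ⟨i, Finset.mem_univ _, ?_⟩)
      simpa [E', E] using hi
  have hE'card : ∀ i, ((E' i).card : ℝ) ≤ ε i * Fintype.card (∀ j, Ω j) := by
    intro i
    have hc : ((E' i).card : ℝ) * Fintype.card (Ω i) =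
        (E i).card * Fintype.card (∀ j, Ω j) := by
      exact_mod_cast card_pi_filter_apply i (E i)
    have hpos : (0 : ℝ) < Fintype.card (Ω i) := by exact_mod_cast Fintype.card_pos
    refine le_of_mul_le_mul_right ?_ hpos
    rw [hc]
    calc ((E i).card : ℝ) * Fintype.card (∀ j, Ω j)
        ≤ (ε i * Fintype.card (Ω i)) * Fintype.card (∀ j, Ω j) := by
          gcongr; exact herr i x
      _ = _ := by ring
  have hcard : ((Finset.univ.filter fun ω : R × (∀ i, Ω i) =>
      Q ω.1 (fun i => P i (ω.2 i) x) ≠ g y).card : ℝ) ≤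
      E₀.card * Fintype.card (∀ i, Ω i) + ∑ i, (Fintype.card R : ℝ) * (E' i).card := by
    have h := (Finset.card_le_card hsub).trans ((Finset.card_union_le _ _).trans
      (Nat.add_le_add_left Finset.card_biUnion_le _))
    simp only [Finset.card_product, Finset.card_univ] at h
    exact_mod_cast h
  refine hcard.trans ?_
  rw [Fintype.card_prod, Nat.cast_mul, add_mul, Finset.sum_mul]
  refine add_le_add ?_ (Finset.sum_le_sum fun i _ => ?_)
  · calc (E₀.card : ℝ) * Fintype.card (∀ i, Ω i)
        ≤ (δ * Fintype.card R) * Fintype.card (∀ i, Ω i) := by gcongr; exact hg y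
      _ = _ := by ring
  · calc (Fintype.card R : ℝ) * (E' i).card
        ≤ Fintype.card R * (ε i * Fintype.card (∀ j, Ω j)) := by gcongr; exact hE'card i
      _ = _ := by ring

/-- A random parity of a nonzero vector vanishes with probability at most `1/2`. -/
theorem two_mul_card_dot_eq_zero_le {ι : Type} [Fintype ι] [DecidableEq ι] {y : ι → ZMod 2}
    (hy : y ≠ 0) :
    2 * (Finset.univ.filter fun r : ι → ZMod 2 => ∑ i, r i * y i = 0).card ≤
      Fintype.card (ι → ZMod 2) := by
  obtain ⟨i, hi⟩ := Function.ne_iff.1 hy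
  have hi1 : y i = 1 := (ZMod.two_eq_zero_or_one _).resolve_left hi
  have hle : (Finset.univ.filter fun r : ι → ZMod 2 => ∑ i, r i * y i = 0).card ≤
      (Finset.univ.filter fun r : ι → ZMod 2 => ¬∑ i, r i * y i = 0).card := by
    refine Finset.card_le_card_of_injOn (fun r => r + Pi.single i 1) ?_
      (fun _ _ _ _ h => add_right_cancel h)
    intro r hr
    have hr' : ∑ i, r i * y i = 0 := by simpa using hr
    simp [add_mul, Finset.sum_add_distrib, hr', Pi.single_apply, hi1]
  have := Finset.card_filter_add_card_filter_not
    (s := (Finset.univ : Finset (ι → ZMod 2))) (fun r => ∑ i, r i * y i = 0)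
  rw [Finset.card_univ] at this
  omega

/-- Razborov's approximation of `OR` by `1 + ∏ j < 5, (1 + ∑ i, rⱼᵢ yᵢ)`, with five random
parities. -/
theorem IsApproximable.or {n D : ℕ} {ι : Type} [Fintype ι] {ε : ι → ℝ}
    {f : ι → (Fin n → Bool) → ZMod 2} (hf : ∀ i, IsApproximable (ε i) D (f i))
    (hε : ∑ i, ε i ≤ 1 / 32) :
    IsApproximable (1 / 16) (5 * D) fun x => bitToF2 (decide (∃ i, f i x = 1)) := by
  classical
  refine (IsApproximable.comp (R := Fin 5 → ι → ZMod 2) (δ := 1 / 32) (c := 5) hf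
    (fun y => bitToF2 (decide (∃ i, y i = 1)))
    (fun r y => 1 + ∏ j, (1 + ∑ i, r j i * y i)) ?_ ?_).mono (by linarith) le_rfl
  · intro r p hp
    have hprod := prod_mem_lowDegree (n := n) Finset.univ (D := fun _ : Fin 5 => D)
      (p := fun j => 1 + ∑ i, r j i • p i) fun j _ =>
        Submodule.add_mem _ (one_mem_lowDegree n D)
          (Submodule.sum_mem _ fun i _ => Submodule.smul_mem _ _ (hp i))
    have h := Submodule.add_mem _ (one_mem_lowDegree n (5 * D))
      (show _ ∈ lowDegree n (5 * D) by simpa using hprod)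
    convert h using 1
    funext x
    simp [Finset.prod_apply]
  · intro y
    by_cases hy : y = 0
    · subst hy
      simp [bitToF2, CharTwo.add_self_eq_zero]
    · have hex : ∃ i, y i = 1 := by
        obtain ⟨i, hi⟩ := Function.ne_iff.1 hy
        exact ⟨i, (ZMod.two_eq_zero_or_one _).resolve_left hi⟩
      set B := Finset.univ.filter fun r : ι → ZMod 2 => ∑ i, r i * y i = 0 with hB
      have hsub : (Finset.univ.filter fun r : Fin 5 → ι → ZMod 2 =>
          1 + ∏ j, (1 + ∑ i, r j i * y i) ≠ bitToF2 (decide (∃ i, y i = 1))) ⊆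
          Fintype.piFinset fun _ => B := by
        intro r hr
        simp only [hex, decide_true, bitToF2, if_true, Finset.mem_filter, Finset.mem_univ,
          true_and, ne_eq, add_eq_left, Finset.prod_eq_zero_iff, not_exists] at hr
        simp only [Fintype.mem_piFinset, hB, Finset.mem_filter, Finset.mem_univ, true_and]
        intro j
        refine (ZMod.two_eq_zero_or_one _).resolve_right fun h => hr j ?_
        rw [h]; decide
      have hcard := Finset.card_le_card hsub
      rw [Fintype.card_piFinset, Finset.prod_const, Finset.card_univ, Fintype.card_fin] at hcard
      have hB2 : 2 * (B.card : ℝ) ≤ Fintype.card (ι → ZMod 2) := by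
        exact_mod_cast two_mul_card_dot_eq_zero_le hy
      have hR : (Fintype.card (Fin 5 → ι → ZMod 2) : ℝ) =
          (Fintype.card (ι → ZMod 2) : ℝ) ^ 5 := by
        rw [Fintype.card_pi, Finset.prod_const, Finset.card_univ, Fintype.card_fin, Nat.cast_pow]
      rw [hR]
      calc _ ≤ (B.card : ℝ) ^ 5 := by exact_mod_cast hcard
        _ = 1 / 32 * (2 * (B.card : ℝ)) ^ 5 := by ring
        _ ≤ 1 / 32 * (Fintype.card (ι → ZMod 2) : ℝ) ^ 5 := by gcongr

theorem IsApproximable.sum {n D : ℕ} {ι : Type} [Fintype ι] {ε : ι → ℝ}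
    {f : ι → (Fin n → Bool) → ZMod 2} (hf : ∀ i, IsApproximable (ε i) D (f i)) :
    IsApproximable (∑ i, ε i) D fun x => ∑ i, f i x := by
  have h := IsApproximable.comp (R := Unit) (δ := 0) (c := 1) hf (fun y => ∑ i, y i)
    (fun _ y => ∑ i, y i) (fun _ p hp => ?_) (fun y => by simp)
  · exact h.mono (by simp) (by simp)
  · rw [one_mul]
    convert Submodule.sum_mem (lowDegree n D) fun i (_ : i ∈ Finset.univ) => hp i using 1
    funext x
    simp

/-! ### Approximating formulas -/

theorem bitToF2_eq_one_iff (b : Bool) : bitToF2 b = 1 ↔ b = true := by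
  cases b <;> decide

theorem bitToF2_not (b : Bool) : bitToF2 (!b) = bitToF2 b + 1 := by
  cases b <;> decide

theorem bitToF2_exists {ι : Type} (b : ι → Bool) {_ : Decidable (∃ i, b i = true)}
    {_ : Decidable (∃ i, bitToF2 (b i) = 1)} :
    bitToF2 (decide (∃ i, b i = true)) = bitToF2 (decide (∃ i, bitToF2 (b i) = 1)) := by
  simp only [bitToF2_eq_one_iff]

theorem bitToF2_forall {ι : Type} (b : ι → Bool) {_ : Decidable (∀ i, b i = true)}
    {_ : Decidable (∃ i, bitToF2 (b i) + 1 = 1)} :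
    bitToF2 (decide (∀ i, b i = true)) = bitToF2 (decide (∃ i, bitToF2 (b i) + 1 = 1)) + 1 := by
  have key : ∀ a : Bool, bitToF2 a + 1 = 1 ↔ ¬a = true := by decide
  rw [← bitToF2_not]
  congr 1
  rw [Bool.eq_iff_iff]
  simp [key]

theorem bitToF2_forall_eq_prod {ι : Type} [Fintype ι] (b : ι → Bool)
    {_ : Decidable (∀ i, b i = true)} :
    bitToF2 (decide (∀ i, b i = true)) = ∏ i, bitToF2 (b i) := by
  by_cases h : ∀ i, b i = true
  · simp [h, bitToF2]
  · obtain ⟨i, hi⟩ := not_forall.1 h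
    rw [Finset.prod_eq_zero (Finset.mem_univ i) (by simp [bitToF2, hi])]
    simp [h, bitToF2]

theorem bitToF2_exists_eq_prod {ι : Type} [Fintype ι] (b : ι → Bool)
    {_ : Decidable (∃ i, b i = true)} :
    bitToF2 (decide (∃ i, b i = true)) = ∏ i, (bitToF2 (b i) + 1) + 1 := by
  by_cases h : ∃ i, b i = true
  · obtain ⟨i, hi⟩ := h
    have hex : ∃ i, b i = true := ⟨i, hi⟩
    rw [Finset.prod_eq_zero (Finset.mem_univ i) (by rw [hi]; decide)]
    simp [hex, bitToF2]
  · rw [Finset.prod_eq_one fun i _ => ?_]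
    · rw [decide_eq_false h]; decide
    · rw [Bool.eq_false_iff.2 fun hi => h ⟨i, hi⟩]; decide

theorem bitToF2_odd_card {ι : Type} [Fintype ι] (b : ι → Bool) :
    bitToF2 (decide (Odd (Finset.univ.filter fun i => b i = true).card)) =
      ∑ i, bitToF2 (b i) := by
  simp only [bitToF2, Finset.sum_boole, decide_eq_true_eq]
  split_ifs with h
  · exact ((ZMod.natCast_eq_one_iff_odd).2 h).symm
  · exact ((ZMod.natCast_eq_zero_iff_even).2 (Nat.not_odd_iff_even.1 h)).symm

namespace ParityFormula

/-- The value of a formula, as an `𝔽₂`-valued function on the cube. -/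
def evalF2 {n : ℕ} (F : ParityFormula n) (x : Fin n → Bool) : ZMod 2 := bitToF2 (F.eval x)

theorem evalF2_not {n : ℕ} (F : ParityFormula n) : (not F).evalF2 = F.evalF2 + 1 := by
  funext x
  exact bitToF2_not _

theorem size_pos {n : ℕ} (F : ParityFormula n) : 0 < F.size := by
  induction F with
  | var i => exact one_pos
  | const b => exact one_pos
  | not F ih => exact ih
  | and F ih => exact Finset.sum_pos (fun i _ => ih i) Finset.univ_nonempty
  | or F ih => exact Finset.sum_pos (fun i _ => ih i) Finset.univ_nonempty
  | mod2 F ih => exact Finset.sum_pos (fun i _ => ih i) Finset.univ_nonempty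

theorem evalF2_mem_lowDegree_size {n : ℕ} (F : ParityFormula n) :
    F.evalF2 ∈ lowDegree n F.size := by
  induction F with
  | var i => exact coord_mem_lowDegree i
  | const b => exact const_mem_lowDegree 1 (bitToF2 b)
  | not F ih =>
    rw [evalF2_not]
    exact Submodule.add_mem _ ih (one_mem_lowDegree n _)
  | and F ih =>
    have h := prod_mem_lowDegree Finset.univ fun i _ => ih i
    change _ ∈ lowDegree n (∑ i, (F i).size)
    convert h using 1
    funext x
    rw [Finset.prod_apply]
    exact bitToF2_forall_eq_prod fun i => (F i).eval x
  | or F ih =>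
    have h := Submodule.add_mem _ (prod_mem_lowDegree Finset.univ fun i _ =>
      Submodule.add_mem _ (ih i) (one_mem_lowDegree n _)) (one_mem_lowDegree n _)
    change _ ∈ lowDegree n (∑ i, (F i).size)
    convert h using 1
    funext x
    rw [Pi.add_apply, Finset.prod_apply]
    exact bitToF2_exists_eq_prod fun i => (F i).eval x
  | mod2 F ih =>
    have h := Submodule.sum_mem (lowDegree n (mod2 F).size) fun i (_ : i ∈ Finset.univ) =>
      lowDegree_mono (Finset.single_le_sum (f := fun i => (F i).size)
        (fun j _ => Nat.zero_le _) (Finset.mem_univ i)) (ih i)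
    convert h using 1
    funext x
    rw [Finset.sum_apply]
    exact bitToF2_odd_card _

theorem evalF2_mem_lowDegree_one {n : ℕ} (F : ParityFormula n) (hF : F.depth = 0) :
    F.evalF2 ∈ lowDegree n 1 := by
  induction F with
  | var i => exact coord_mem_lowDegree i
  | const b => exact const_mem_lowDegree 1 (bitToF2 b)
  | not F ih =>
    rw [evalF2_not]
    exact Submodule.add_mem _ (ih hF) (one_mem_lowDegree n _)
  | and F _ => exact absurd hF (Nat.succ_ne_zero _)
  | or F _ => exact absurd hF (Nat.succ_ne_zero _)
  | mod2 F _ => exact absurd hF (Nat.succ_ne_zero _)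

theorem isApproximable_or {n k D : ℕ} {F : Fin (k + 1) → ParityFormula n} {ε : Fin (k + 1) → ℝ}
    (hF : ∀ i, IsApproximable (ε i) D (F i).evalF2) (hε : ∑ i, ε i ≤ 1 / 32) :
    IsApproximable (1 / 16) (5 * D) (or F).evalF2 := by
  convert IsApproximable.or hF hε using 1
  funext x
  exact bitToF2_exists fun i => (F i).eval x

theorem isApproximable_and {n k D : ℕ} {F : Fin (k + 1) → ParityFormula n} {ε : Fin (k + 1) → ℝ}
    (hF : ∀ i, IsApproximable (ε i) D (F i).evalF2) (hε : ∑ i, ε i ≤ 1 / 32) :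
    IsApproximable (1 / 16) (5 * D) (and F).evalF2 := by
  convert (IsApproximable.or (fun i => (hF i).add_one) hε).add_one using 1
  funext x
  exact bitToF2_forall fun i => (F i).eval x

theorem isApproximable_mod2 {n k D : ℕ} {F : Fin (k + 1) → ParityFormula n}
    {ε : Fin (k + 1) → ℝ} (hF : ∀ i, IsApproximable (ε i) D (F i).evalF2)
    (hε : ∑ i, ε i ≤ 1 / 32) : IsApproximable (1 / 16) (5 * D) (mod2 F).evalF2 := by
  have h := (IsApproximable.sum hF).mono (hε.trans (by norm_num : (1 / 32 : ℝ) ≤ 1 / 16))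
    (by omega : D ≤ 5 * D)
  convert h using 1
  funext x
  exact bitToF2_odd_card _

/-- The degree that suffices to approximate formulas of size `s` and depth `e + 1`. For `e = 0`
the base of the power is a division by zero, and the value is `5`. -/
noncomputable def degreeBound (e : ℕ) (s : ℝ) : ℝ :=
  5 * (30 * ((Real.logb 2 s + e) / e)) ^ e

/-- A case of the inequality of arithmetic and geometric means, for one number `b + 1` and `e`
copies of `(a + e) / e`; it is an instance of Bernoulli's inequality. -/
theorem mul_div_pow_le (e : ℕ) {a b : ℝ} (ha : 0 ≤ a) (hb : 0 ≤ b) :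
    (b + 1) * ((a + e) / e) ^ e ≤ ((a + b + (e + 1)) / (e + 1)) ^ (e + 1) := by
  rcases Nat.eq_zero_or_pos e with rfl | he
  · simp; linarith
  · have he' : (0 : ℝ) < e := by exact_mod_cast he
    set y := (a + e) / e with hy
    have hy0 : 0 < y := by positivity
    have hey : e * y = a + e := by rw [hy]; field_simp
    have hB := one_add_mul_le_pow (a := ((b + 1) / y - 1) / (e + 1)) (by
      rw [le_div_iff₀ (by positivity)]
      have : 0 < (b + 1) / y := by positivity
      linarith) (e + 1)
    have e1 : 1 + ((e + 1 : ℕ) : ℝ) * (((b + 1) / y - 1) / (e + 1)) = (b + 1) / y := by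
      push_cast; field_simp; ring
    have e2 : 1 + ((b + 1) / y - 1) / (e + 1) = (a + b + (e + 1)) / (e + 1) / y := by
      rw [show a + b + ((e : ℝ) + 1) = e * y + b + 1 by rw [hey]; ring]
      field_simp; ring
    rw [e1, e2, div_pow, div_le_div_iff₀ hy0 (by positivity), pow_succ y] at hB
    have : ((b + 1) * y ^ e) * y ≤ ((a + b + (e + 1)) / (e + 1)) ^ (e + 1) * y := by linarith
    exact le_of_mul_le_mul_right this hy0

/-- A child of size `s` gets the share `s / (32 S)` of the error `1/32` that a gate of size `S`
may inherit. The number `t` of samples that reduces the error of the child to this share costs no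
more than the passage from `degreeBound e s` to `degreeBound (e + 1) S`. -/
theorem exists_samples {e D : ℕ} {s S : ℝ} (hs : 1 ≤ s) (hS : s ≤ S)
    (hD : D ≤ degreeBound e s) :
    ∃ t : ℕ, (1 / 2 : ℝ) ^ t ≤ s / (32 * S) ∧ 5 * (t * D) ≤ degreeBound (e + 1) S := by
  have hs0 : 0 < s := by linarith
  have hS0 : 0 < S := by linarith
  have ha : 0 ≤ Real.logb 2 s := Real.logb_nonneg (by norm_num) hs
  have hb : 0 ≤ Real.logb 2 S - Real.logb 2 s := by
    have := Real.logb_le_logb_of_le (by norm_num : (1 : ℝ) < 2) hs0 hS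
    linarith
  set a := Real.logb 2 s with ha_def
  set b := Real.logb 2 S - a with hb_def
  have hlog : Real.logb 2 (32 * S / s) = 5 + b := by
    rw [Real.logb_div (by positivity) (by positivity), Real.logb_mul (by norm_num) (by positivity),
      show (32 : ℝ) = 2 ^ (5 : ℕ) by norm_num, Real.logb_pow, Real.logb_self_eq_one (by norm_num)]
    rw [hb_def]; push_cast; ring
  refine ⟨⌈5 + b⌉₊, ?_, ?_⟩
  · have h1 : 32 * S / s ≤ 2 ^ ⌈5 + b⌉₊ := by
      rw [← Real.rpow_natCast]
      refine (Real.logb_le_iff_le_rpow (by norm_num) (by positivity)).1 ?_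
      rw [hlog]
      exact Nat.le_ceil _
    rw [one_div, inv_pow, show s / (32 * S) = (32 * S / s)⁻¹ by rw [inv_div]]
    exact inv_anti₀ (by positivity) h1
  · have ht : (⌈5 + b⌉₊ : ℝ) ≤ 6 * (b + 1) := by
      have := (Nat.ceil_lt_add_one (by linarith : 0 ≤ 5 + b)).le
      linarith
    have hbound : 0 ≤ degreeBound e s := by
      rw [degreeBound]; positivity
    have hkey := mul_div_pow_le e ha hb
    have hab : a + b = Real.logb 2 S := by rw [hb_def]; ring
    rw [hab] at hkey
    calc 5 * ((⌈5 + b⌉₊ : ℝ) * D) ≤ 5 * ((6 * (b + 1)) * degreeBound e s) := by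
          gcongr
      _ = 5 * 30 ^ (e + 1) * ((b + 1) * ((a + e) / e) ^ e) := by
          rw [degreeBound, mul_pow]; ring
      _ ≤ 5 * 30 ^ (e + 1) * ((Real.logb 2 S + (e + 1)) / (e + 1)) ^ (e + 1) := by gcongr
      _ = degreeBound (e + 1) S := by
          rw [degreeBound, mul_pow]; push_cast; ring

theorem exists_isApproximable_children {n k e : ℕ} (F : Fin (k + 1) → ParityFormula n)
    (ih : ∀ i, ∀ e : ℕ, (F i).depth ≤ e + 1 → ∃ D : ℕ, (D : ℝ) ≤ degreeBound e (F i).size ∧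
      IsApproximable (1 / 16) D (F i).evalF2)
    (hF : (Finset.univ.sup fun i => (F i).depth) + 1 ≤ e + 1) :
    ∃ (ε : Fin (k + 1) → ℝ) (D : ℕ), ∑ i, ε i ≤ 1 / 32 ∧
      ((5 * D : ℕ) : ℝ) ≤ degreeBound e (∑ i, (F i).size : ℕ) ∧
      ∀ i, IsApproximable (ε i) D (F i).evalF2 := by
  have hdepth : ∀ i, (F i).depth ≤ e := fun i =>
    (Finset.le_sup (f := fun i => (F i).depth) (Finset.mem_univ i)).trans (by omega)
  cases e with
  | zero =>
    refine ⟨0, 1, by simp, by simp [degreeBound], fun i => ?_⟩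
    exact .of_mem (evalF2_mem_lowDegree_one _ (Nat.le_zero.1 (hdepth i)))
  | succ e =>
    set S : ℕ := ∑ i, (F i).size with hS
    choose D hD hD' using fun i => ih i e (hdepth i)
    have hle : ∀ i, (F i).size ≤ S := fun i =>
      Finset.single_le_sum (f := fun i => (F i).size) (fun j _ => Nat.zero_le _)
        (Finset.mem_univ i)
    have hS0 : (0 : ℝ) < S := by exact_mod_cast (F 0).size_pos.trans_le (hle 0)
    have hex := fun i => exists_samples (S := S) (by exact_mod_cast (F i).size_pos)
      (by exact_mod_cast hle i) (hD i)
    choose t ht ht' using hex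
    have hA : 0 ≤ degreeBound (e + 1) S / 5 := by
      have h := ht' 0
      have : (0 : ℝ) ≤ 5 * (t 0 * D 0) := by positivity
      linarith
    refine ⟨fun i => (F i).size / (32 * S), ⌊degreeBound (e + 1) S / 5⌋₊, ?_, ?_, fun i => ?_⟩
    · rw [← Finset.sum_div, ← Nat.cast_sum, ← hS]
      exact le_of_eq (by field_simp)
    · have := Nat.floor_le hA
      push_cast
      linarith
    · refine ((hD' i).amplify (t i)).mono (ht i) (Nat.le_floor ?_)
      have := ht' i
      push_cast
      linarith

/-- A formula of size `s` and depth at most `e + 1` has a random polynomial of degree at most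
`degreeBound e s` with error `1/16`. -/
theorem exists_isApproximable {n : ℕ} (F : ParityFormula n) :
    ∀ e : ℕ, F.depth ≤ e + 1 → ∃ D : ℕ, (D : ℝ) ≤ degreeBound e F.size ∧
      IsApproximable (1 / 16) D F.evalF2 := by
  have hlit : ∀ (G : ParityFormula n) (e : ℕ), G.depth = 0 → ∃ D : ℕ,
      (D : ℝ) ≤ degreeBound e G.size ∧ IsApproximable (1 / 16) D G.evalF2 := by
    intro G e hG
    refine ⟨1, ?_, (IsApproximable.of_mem (evalF2_mem_lowDegree_one G hG)).mono
      (by norm_num) le_rfl⟩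
    have hbase : 1 ≤ (30 * ((Real.logb 2 G.size + e) / e)) ^ e := by
      rcases Nat.eq_zero_or_pos e with rfl | he
      · simp
      · have he' : (0 : ℝ) < e := by exact_mod_cast he
        refine one_le_pow₀ ?_
        have hl : 0 ≤ Real.logb 2 (G.size : ℝ) :=
          Real.logb_nonneg (by norm_num) (by exact_mod_cast G.size_pos)
        have : 1 ≤ (Real.logb 2 G.size + e) / e := by
          rw [le_div_iff₀ he']; linarith
        linarith
    rw [degreeBound, Nat.cast_one]
    linarith
  induction F with
  | var i => exact fun e _ => hlit _ e rfl
  | const b => exact fun e _ => hlit _ e rfl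
  | not F ih =>
    intro e he
    obtain ⟨D, hD, h⟩ := ih e he
    exact ⟨D, hD, by rw [evalF2_not]; exact h.add_one⟩
  | and F ih =>
    intro e he
    obtain ⟨ε, D, hε, hD, h⟩ := exists_isApproximable_children F ih he
    exact ⟨5 * D, hD, isApproximable_and h hε⟩
  | or F ih =>
    intro e he
    obtain ⟨ε, D, hε, hD, h⟩ := exists_isApproximable_children F ih he
    exact ⟨5 * D, hD, isApproximable_or h hε⟩
  | mod2 F ih =>
    intro e he
    obtain ⟨ε, D, hε, hD, h⟩ := exists_isApproximable_children F ih he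
    exact ⟨5 * D, hD, isApproximable_mod2 h hε⟩

/-! ### The size of formulas that approximate Majority -/

/-- If a formula computes an approximate majority, then polynomials close to the formula have
degree of order `√n`. -/
theorem sqrt_le_of_mem_lowDegree {n D : ℕ} {f : (Fin n → Bool) → Bool} {F : ParityFormula n}
    (hf : IsApproxMajority (1 / 4) f) (hF : F.Computes f) {p : (Fin n → Bool) → ZMod 2}
    (hp : p ∈ lowDegree n D)
    (hpF : ((Finset.univ.filter fun x => p x ≠ F.evalF2 x).card : ℝ) ≤ 1 / 16 * 2 ^ n) :
    3 / 16 * √n ≤ D + 1 := by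
  refine sqrt_le_of_approximates_majority hp ?_
  have hsub : (Finset.univ.filter fun x => p x ≠ bitToF2 (majority n x)) ⊆
      (Finset.univ.filter fun x => p x ≠ F.evalF2 x) ∪
        Finset.univ.filter fun x => f x ≠ majority n x := by
    intro x hx
    simp only [Finset.mem_union, Finset.mem_filter, Finset.mem_univ, true_and] at hx ⊢
    by_contra! h
    exact hx (by rw [h.1, evalF2, hF x, h.2])
  have h1 : ((Finset.univ.filter fun x => p x ≠ bitToF2 (majority n x)).card : ℝ) ≤
      (Finset.univ.filter fun x => p x ≠ F.evalF2 x).card +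
        (Finset.univ.filter fun x => f x ≠ majority n x).card := by
    exact_mod_cast (Finset.card_le_card hsub).trans (Finset.card_union_le _ _)
  have h2 := (div_le_iff₀ (by positivity)).1 hf
  linarith

theorem sqrt_le_size_add_one {n : ℕ} {f : (Fin n → Bool) → Bool} {F : ParityFormula n}
    (hf : IsApproxMajority (1 / 4) f) (hF : F.Computes f) : 3 / 16 * √n ≤ F.size + 1 :=
  sqrt_le_of_mem_lowDegree hf hF (evalF2_mem_lowDegree_size F) (by simp)

theorem sqrt_le_degreeBound_add_one {n e : ℕ} {f : (Fin n → Bool) → Bool} {F : ParityFormula n}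
    (hf : IsApproxMajority (1 / 4) f) (hF : F.Computes f) (he : F.depth ≤ e + 1) :
    3 / 16 * √n ≤ degreeBound e F.size + 1 := by
  obtain ⟨D, hD, happ⟩ := F.exists_isApproximable e he
  obtain ⟨p, hp, hpF⟩ := happ.exists_card_ne_le
  exact (sqrt_le_of_mem_lowDegree hf hF hp hpF).trans (by linarith)

theorem rpow_le_logb_size {n e : ℕ} {f : (Fin n → Bool) → Bool} {F : ParityFormula n}
    (hf : IsApproxMajority (1 / 4) f) (hF : F.Computes f) (he : F.depth ≤ e + 1) (he0 : 0 < e) :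
    (n : ℝ) ^ (1 / (2 * (e : ℝ))) ≤ 960 * (Real.logb 2 F.size / e + 1) := by
  have he' : (0 : ℝ) < e := by exact_mod_cast he0
  have hl : 0 ≤ Real.logb 2 (F.size : ℝ) :=
    Real.logb_nonneg (by norm_num) (by exact_mod_cast F.size_pos)
  set y := Real.logb 2 (F.size : ℝ) / e + 1 with hy
  have hy1 : 1 ≤ y := by
    have : 0 ≤ Real.logb 2 (F.size : ℝ) / e := by positivity
    linarith
  have h := sqrt_le_degreeBound_add_one hf hF he
  have hdb : degreeBound e F.size = 5 * (30 * y) ^ e := by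
    rw [degreeBound, hy]
    congr 3
    field_simp
  have h1 : 1 ≤ (30 * y) ^ e := one_le_pow₀ (by linarith)
  have h32 : (32 : ℝ) ≤ 32 ^ e := le_self_pow₀ (by norm_num) he0.ne'
  have hsqrt : √(n : ℝ) ≤ (960 * y) ^ e := by
    calc √(n : ℝ) ≤ 32 * (30 * y) ^ e := by linarith
      _ ≤ 32 ^ e * (30 * y) ^ e := by gcongr
      _ = (960 * y) ^ e := by rw [← mul_pow]; ring
  calc (n : ℝ) ^ (1 / (2 * (e : ℝ))) = √(n : ℝ) ^ (e : ℝ)⁻¹ := by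
        rw [Real.sqrt_eq_rpow, ← Real.rpow_mul (Nat.cast_nonneg n)]
        congr 1
        field_simp
    _ ≤ ((960 * y) ^ e) ^ (e : ℝ)⁻¹ := by gcongr
    _ = 960 * y := Real.pow_rpow_inv_natCast (by positivity) he0.ne'

/-- A formula that computes an approximate majority has polynomial size, whatever its depth. -/
theorem log_le_log_size {n : ℕ} {f : (Fin n → Bool) → Bool} {F : ParityFormula n}
    (hf : IsApproxMajority (1 / 4) f) (hF : F.Computes f) (hn : 4096 ≤ n) :
    Real.log n / 4 ≤ Real.log F.size := by
  have h := sqrt_le_size_add_one hf hF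
  have hn' : (4096 : ℝ) ≤ n := by exact_mod_cast hn
  have hq2 : √√(n : ℝ) ^ 2 = √n := Real.sq_sqrt (Real.sqrt_nonneg _)
  have hq : 8 ≤ √√(n : ℝ) := by
    refine Real.le_sqrt_of_sq_le (Real.le_sqrt_of_sq_le ?_)
    norm_num
    exact hn
  have hle : √√(n : ℝ) ≤ F.size := by nlinarith
  have := Real.log_le_log (by linarith) hle
  rw [Real.log_sqrt (Real.sqrt_nonneg _), Real.log_sqrt (Nat.cast_nonneg n)] at this
  linarith

end ParityFormula

theorem mainTheorem3 :
    ∀ K : ℝ, 0 < K → ∃ c : ℝ, 0 < c ∧ ∃ n₀ : ℕ, ∀ n : ℕ, n₀ ≤ n →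
      ∀ d : ℕ, 2 ≤ d → (d : ℝ) ≤ K * Real.log (n : ℝ) →
        ∀ f : (Fin n → Bool) → Bool, IsApproxMajority (1 / 4 : ℝ) f →
          ∀ F : ParityFormula n, F.Computes f → F.depth ≤ d →
            Real.exp (c * (d : ℝ) * (n : ℝ) ^ (1 / (2 * ((d : ℝ) - 1)))) ≤ (F.size : ℝ) := by
  intro K hK
  refine ⟨min (1 / 7680) (1 / (7680 * K)), by positivity, 4096, ?_⟩
  intro n hn d hd hdK f hf F hF hdepth
  have hs : (0 : ℝ) < F.size := by exact_mod_cast F.size_pos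
  obtain ⟨e, rfl⟩ : ∃ e, d = e + 1 := ⟨d - 1, by omega⟩
  have he0 : 0 < e := by omega
  have he1 : (1 : ℝ) ≤ e := by exact_mod_cast he0
  have hN := F.rpow_le_logb_size hf hF hdepth he0
  have hlog := F.log_le_log_size hf hF hn
  rw [← Real.le_log_iff_exp_le hs]
  rw [show ((e + 1 : ℕ) : ℝ) - 1 = e by push_cast; ring]
  push_cast at hdK ⊢
  set N := (n : ℝ) ^ (1 / (2 * (e : ℝ)))
  have hN0 : 0 ≤ N := by positivity
  by_cases hcase : 1920 ≤ N
  · have h1 : N / 1920 ≤ Real.logb 2 F.size / e := by linarith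
    rw [le_div_iff₀ (by linarith)] at h1
    have h2 : Real.log F.size = Real.logb 2 F.size * Real.log 2 := by
      rw [Real.logb, div_mul_cancel₀ _ (by positivity)]
    have h3 := Real.log_two_gt_d9
    calc min (1 / 7680) (1 / (7680 * K)) * ((e : ℝ) + 1) * N
        ≤ 1 / 7680 * (2 * e) * N := by
          gcongr
          · exact min_le_left _ _
          · linarith
      _ = N / 1920 * e * (1 / 2) := by ring
      _ ≤ Real.logb 2 F.size * Real.log 2 := by
          gcongr
          · exact le_trans (by positivity) h1
          · linarith
      _ = Real.log F.size := h2.symm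
  -- Here the depth is of order `log n`, and the bound asks only for a power of `n`.
  · calc min (1 / 7680) (1 / (7680 * K)) * ((e : ℝ) + 1) * N
        ≤ 1 / (7680 * K) * (K * Real.log n) * 1920 := by
          gcongr
          · exact min_le_right _ _
          · linarith
      _ = Real.log n / 4 := by field_simp; ring
      _ ≤ Real.log F.size := hlog
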